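/- Let $(R,\mathfrak m)$ be a Noetherian local domain of dimension $d$, and let $\{M_n\}$ be a sequence of finitely generated $R$-modules of dimension $d$. Suppose that for all $n$ and all $j<d$ the local cohomology module $H^j_{\mathfrak m}(M_n)$ has finite length, and that for every $j<d$, as $n\to\infty$, $$\ell\bigl(H^j_{\mathfrak m}(M_n)\bigr)=o(\operatorname{rank}_R M_n).$$ Then $\{M_n\}$ is a lim Cohen–Macaulay sequence, and hence also a weakly lim Cohen–Macaulay sequence. Here $\nu(M)$ is the minimal number of generators of $M$ and $H_i(\underline x,M)$ is Koszul homology. A sequence $\{M_n\}$ of finitely generated $R$-modules of dimension $d$ is lim Cohen–Macaulay if there is a system of parameters $\underline x=x_1,\dots,x_d$ of $R$ such that $\ell(H_i(\underline x,M_n))=o(\nu(M_n))$ for all $i\ge 1$. It is weakly lim Cohen–Macaulay if there is a system of parameters $\underline x=x_1,\dots,x_d$ of $R$ such that $\chi_1(\underline x,M_n)=o(\nu(M_n))$, where $\chi_1(\underline x,M)=\sum_{i=1}^d(-1)^{i-1}\ell(H_i(\underline x,M))$. -/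

import Mathlib

open CategoryTheory Filter Asymptotics

universe u v

noncomputable section

namespace LimCM

section Koszul

variable {R : Type u} [CommRing R] {d : ℕ}

/-- The underlying module of the `p`-th term `K_p(x; M) = ⋀^p(R^d) ⊗ M` of the Koszul complex, with
`⋀^p(R^d)` written in its standard basis `e_S`, `S ⊆ {0, …, d-1}` with `p` elements: a family
`(m_S)_S` stands for `∑ S, e_S ⊗ m_S`. -/
abbrev KoszulTerm (d p : ℕ) (M : Type v) : Type v :=
  {S : Finset (Fin d) // S.card = p} → M

/-- The coefficient `(-1)^{#{j ∈ T : j < i}} x_i` of `e_T` in `∂ e_{T ∪ {i}}`, for `i ∉ T`. -/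
def koszulCoeff (x : Fin d → R) (T : Finset (Fin d)) (i : Fin d) : R :=
  (-1) ^ (T.filter (fun j => j < i)).card * x i

variable (M : Type v) [AddCommGroup M] [Module R M]

/-- The Koszul differential `K_{p+1}(x; M) → K_p(x; M)`, that is
`∂ (e_S ⊗ m) = ∑ i ∈ S, (-1)^{#{j ∈ S : j < i}} e_{S \ {i}} ⊗ x_i m`,
written on coordinates. -/
def koszulDifferential (x : Fin d → R) (p : ℕ) :
    KoszulTerm d (p + 1) M →ₗ[R] KoszulTerm d p M where
  toFun m T := ∑ i : Fin d,
    if h : i ∉ T.1 then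
      koszulCoeff x T.1 i • m ⟨insert i T.1, by rw [Finset.card_insert_of_notMem h, T.2]⟩
    else 0
  map_add' m m' := by
    ext T
    simp only [Pi.add_apply, ← Finset.sum_add_distrib]
    refine Finset.sum_congr rfl fun i _ => ?_
    split_ifs <;> simp
  map_smul' r m := by
    ext T
    simp only [Pi.smul_apply, RingHom.id_apply, Finset.smul_sum]
    refine Finset.sum_congr rfl fun i _ => ?_
    split_ifs
    · rw [smul_zero]
    · rw [smul_comm]

lemma koszulCoeff_anticomm (x : Fin d → R) (T : Finset (Fin d)) {i j : Fin d}
    (hi : i ∉ T) (hj : j ∉ T) (hij : i ≠ j) :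
    koszulCoeff x T i * koszulCoeff x (insert i T) j +
      koszulCoeff x T j * koszulCoeff x (insert j T) i = 0 := by
  wlog h : i < j generalizing i j
  · rw [add_comm]
    exact this hj hi hij.symm (lt_of_le_of_ne (not_lt.mp h) hij.symm)
  · unfold koszulCoeff
    rw [Finset.filter_insert, if_pos h, Finset.filter_insert, if_neg h.not_gt,
      Finset.card_insert_of_notMem (by simp [hi])]
    ring

lemma koszulDifferential_comp (x : Fin d → R) (p : ℕ) :
    koszulDifferential M x p ∘ₗ koszulDifferential M x (p + 1) = 0 := by
  refine LinearMap.ext fun m => funext fun T => ?_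
  simp only [LinearMap.comp_apply, koszulDifferential, LinearMap.coe_mk, AddHom.coe_mk,
    LinearMap.zero_apply, Pi.zero_apply]
  let m' : Finset (Fin d) → M := fun S => if h : S.card = p + 1 + 1 then m ⟨S, h⟩ else 0
  let a : Fin d × Fin d → M := fun q =>
    if q.1 ∉ T.1 ∧ q.2 ∉ T.1 ∧ q.1 ≠ q.2 then
      (koszulCoeff x T.1 q.1 * koszulCoeff x (insert q.1 T.1) q.2) •
        m' (insert q.2 (insert q.1 T.1))
    else 0
  have key : ∑ q : Fin d × Fin d, a q = 0 := by
    refine Finset.sum_involution (fun q _ => (q.2, q.1)) ?_ ?_ ?_ ?_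
    · rintro ⟨i, j⟩ -
      by_cases h : i ∉ T.1 ∧ j ∉ T.1 ∧ i ≠ j
      · have h' : j ∉ T.1 ∧ i ∉ T.1 ∧ j ≠ i := ⟨h.2.1, h.1, h.2.2.symm⟩
        simp only [a, if_pos h, if_pos h']
        rw [Finset.insert_comm i j, ← add_smul,
          koszulCoeff_anticomm x T.1 h.1 h.2.1 h.2.2, zero_smul]
      · have h' : ¬ (j ∉ T.1 ∧ i ∉ T.1 ∧ j ≠ i) := fun h' => h ⟨h'.2.1, h'.1, h'.2.2.symm⟩
        simp only [a, if_neg h, if_neg h', add_zero]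
    · rintro ⟨i, j⟩ - hne heq
      simp only [Prod.mk.injEq] at heq
      exact hne (by simp [a, heq.1])
    · simp
    · simp
  refine Eq.trans ?_ key
  rw [Fintype.sum_prod_type]
  refine Finset.sum_congr rfl fun i _ => ?_
  by_cases hi : i ∈ T.1
  · simp [a, hi]
  · rw [dif_pos hi, Finset.smul_sum]
    refine Finset.sum_congr rfl fun j _ => ?_
    by_cases hj : j ∈ insert i T.1
    · have : ¬ (i ∉ T.1 ∧ j ∉ T.1 ∧ i ≠ j) := by
        rintro ⟨-, h1, h2⟩
        rcases Finset.mem_insert.mp hj with h | h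
        exacts [h2 h.symm, h1 h]
      rw [dif_neg (not_not.mpr hj), smul_zero]
      simp only [a, if_neg this]
    · have h3 : i ∉ T.1 ∧ j ∉ T.1 ∧ i ≠ j :=
        ⟨hi, fun h => hj (Finset.mem_insert_of_mem h),
          fun h => hj (h ▸ Finset.mem_insert_self i T.1)⟩
      have h4 : (insert j (insert i T.1)).card = p + 1 + 1 := by
        rw [Finset.card_insert_of_notMem hj, Finset.card_insert_of_notMem hi, T.2]
      rw [dif_pos hj]
      simp only [a, if_pos h3, m', dif_pos h4, smul_smul]

/-- The Koszul complex `K_•(x; M)` of a finite sequence `x` of elements of `R`. -/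
def koszulComplex (x : Fin d → R) : ChainComplex (ModuleCat.{v} R) ℕ :=
  ChainComplex.of (fun p => ModuleCat.of R (KoszulTerm d p M))
    (fun p => ModuleCat.ofHom (koszulDifferential M x p))
    (fun p => by rw [← ModuleCat.ofHom_comp, koszulDifferential_comp]; rfl)

/-- The Koszul homology module `H_i(x; M)`. -/
def koszulHomology (x : Fin d → R) (i : ℕ) : ModuleCat.{v} R :=
  (koszulComplex M x).homology i

/-- The first higher Euler characteristic `χ₁(x; M) = ∑_{i=1}^d (-1)^{i-1} ℓ(H_i(x; M))`;
meaningful when these Koszul homology modules have finite length. -/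
def chiOne (x : Fin d → R) : ℤ :=
  ∑ i ∈ Finset.Icc 1 d, (-1) ^ (i - 1) * ((Module.length R (koszulHomology M x i)).toNat : ℤ)

end Koszul

section LimCohenMacaulay

variable {R : Type u} [CommRing R] [IsLocalRing R]

/-- `x_1, …, x_d` is a system of parameters of the local ring `R`: the number `d` is the dimension
of `R`, and `x_1, …, x_d` generate an ideal whose radical is the maximal ideal. -/
def IsSystemOfParameters {d : ℕ} (x : Fin d → R) : Prop :=
  ringKrullDim R = d ∧ (Ideal.span (Set.range x)).radical = IsLocalRing.maximalIdeal R

variable (R) (M : ℕ → Type v) [∀ n, AddCommGroup (M n)] [∀ n, Module R (M n)]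

/-- A lim Cohen–Macaulay sequence: finitely generated modules of dimension `dim R` such that, for
some system of parameters `x`, `ℓ(H_i(x; M_n)) = o(ν(M_n))` for every `i ≥ 1`. -/
structure IsLimCohenMacaulay : Prop where
  finite : ∀ n, Module.Finite R (M n)
  supportDim_eq : ∀ n, Module.supportDim R (M n) = ringKrullDim R
  exists_sop : ∃ (d : ℕ) (x : Fin d → R), IsSystemOfParameters x ∧
    ∀ i : ℕ, 1 ≤ i →
      (∀ n, IsFiniteLength R (koszulHomology (M n) x i)) ∧
      (fun n => ((Module.length R (koszulHomology (M n) x i)).toNat : ℝ)) =o[atTop]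
        (fun n => ((⊤ : Submodule R (M n)).spanFinrank : ℝ))

/-- A weakly lim Cohen–Macaulay sequence: finitely generated modules of dimension `dim R` such
that, for some system of parameters `x`, `χ₁(x; M_n) = o(ν(M_n))`. -/
structure IsWeaklyLimCohenMacaulay : Prop where
  finite : ∀ n, Module.Finite R (M n)
  supportDim_eq : ∀ n, Module.supportDim R (M n) = ringKrullDim R
  exists_sop : ∃ (d : ℕ) (x : Fin d → R), IsSystemOfParameters x ∧
    (∀ i : ℕ, 1 ≤ i → ∀ n, IsFiniteLength R (koszulHomology (M n) x i)) ∧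
    (fun n => (chiOne (M n) x : ℝ)) =o[atTop]
      (fun n => ((⊤ : Submodule R (M n)).spanFinrank : ℝ))

end LimCohenMacaulay

end LimCM

end

/-! For any system of parameters `x` and any `R`-module `M`, finitely generated or not, ℓ(H_{p+1}(x;
M)) ≤ ∑_{q < d-p} C(d, p+1+q) ℓ(H^q_m(M)). Only local cohomology below degree `d` enters, with
constants independent of `M`, so for `M_n` the right side is o(rank M_n). Since rank ≤ ν, this gives
the lim Cohen–Macaulay condition, and χ₁ is an alternating sum of `d` such terms.

The bound (`length_koszulHomology_le_sum`) is a dimension shift. Let `L` be the product of the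
localizations `M_{x_k}`, and let `M → L` have kernel `K`, image `N` and cokernel `C`. Some `x_k` is
invertible on each factor of `L`, so `L` has no Koszul homology in positive degrees and no local
cohomology at all. Hence H_{p+1}(N) is a quotient of H_{p+2}(C), and H^q(C) embeds in H^{q+1}(N).
The kernel `K` is `m`-power torsion: it has no local cohomology in positive degrees
(`LC.subsingleton_of_torsion`), so H^{q+1}(N) embeds in H^{q+2}(K) = 0 extended by a quotient of
H^{q+1}(M), and ℓ(K) ≤ ℓ(H^0(M)). Thus H_{p+1}(M) costs C(d, p+1) ℓ(H^0(M)) for `K`, plus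
H_{p+2}(C), whose bound involves the H^{q+1}(M).

The long exact sequences come from `Abelian.Ext`, so local cohomology is rebuilt as `LC` and
identified with `localCohomology`. -/

noncomputable section

namespace LimCM

/-! ### Koszul homology: exact sequences, length bounds, acyclicity -/

section KoszulFunctoriality

variable {R : Type u} [CommRing R] {d : ℕ} (x : Fin d → R)
variable {M N P : Type v} [AddCommGroup M] [Module R M] [AddCommGroup N] [Module R N]
  [AddCommGroup P] [Module R P]

lemma koszulDifferential_apply (p : ℕ) (m : KoszulTerm d (p + 1) M)
    (T : {S : Finset (Fin d) // S.card = p}) :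
    koszulDifferential M x p m T = ∑ i : Fin d,
      if h : i ∉ T.1 then
        koszulCoeff x T.1 i • m ⟨insert i T.1, by rw [Finset.card_insert_of_notMem h, T.2]⟩
      else 0 := rfl

lemma koszulDifferential_compLeft (f : M →ₗ[R] N) (p : ℕ) (m : KoszulTerm d (p + 1) M) :
    koszulDifferential N x p (fun S => f (m S)) = fun S => f (koszulDifferential M x p m S) := by
  funext T
  simp only [koszulDifferential_apply, map_sum]
  refine Finset.sum_congr rfl fun i _ => ?_
  split_ifs <;> simp

variable (M) in
lemma koszulComplex_d (p : ℕ) :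
    (koszulComplex M x).d (p + 1) p = ModuleCat.ofHom (koszulDifferential M x p) :=
  ChainComplex.of_d (fun p => ModuleCat.of R (KoszulTerm d p M))
    (fun p => ModuleCat.ofHom (koszulDifferential M x p)) p

/-- The map of Koszul complexes induced by a linear map. -/
def koszulMap (f : M →ₗ[R] N) : koszulComplex M x ⟶ koszulComplex N x :=
  ChainComplex.ofHom
    (fun p => ModuleCat.ofHom (f.compLeft {S : Finset (Fin d) // S.card = p}))
    (fun p => by
      rw [koszulComplex_d, koszulComplex_d]
      exact ModuleCat.hom_ext (LinearMap.ext fun m => koszulDifferential_compLeft x f p m))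

/-- The short complex of Koszul complexes attached to `M → N → P`. -/
def koszulShortComplex (f : M →ₗ[R] N) (g : N →ₗ[R] P) (h : Function.Exact f g) :
    ShortComplex (ChainComplex (ModuleCat.{v} R) ℕ) :=
  ShortComplex.mk (koszulMap x f) (koszulMap x g) (by
    ext p m
    funext S
    exact h.apply_apply_eq_zero _)

lemma koszulShortComplex_shortExact (f : M →ₗ[R] N) (g : N →ₗ[R] P) (hf : Function.Injective f)
    (hg : Function.Surjective g) (h : Function.Exact f g) :
    (koszulShortComplex x f g h).ShortExact := by
  refine HomologicalComplex.shortExact_of_degreewise_shortExact _ fun p => ?_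
  refine ModuleCat.shortComplex_shortExact _ ?_ ?_ ?_
  · intro m
    constructor
    · intro hm
      choose a ha using fun S => (h (m S)).1 (congrFun hm S)
      exact ⟨a, funext ha⟩
    · rintro ⟨a, rfl⟩
      exact funext fun S => h.apply_apply_eq_zero _
  · exact hf.comp_left
  · exact hg.comp_left

/-- In an exact sequence `A → B → C`, the length of `B` is at most the sum of the other two. -/
lemma length_le_add_of_exact {A B C : Type*} [AddCommGroup A] [Module R A] [AddCommGroup B]
    [Module R B] [AddCommGroup C] [Module R C] (f : A →ₗ[R] B) (g : B →ₗ[R] C)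
    (h : Function.Exact f g) :
    Module.length R B ≤ Module.length R A + Module.length R C := by
  rw [Module.length_eq_add_of_exact (LinearMap.ker g).subtype g.rangeRestrict
    Subtype.val_injective g.surjective_rangeRestrict
    (by rw [LinearMap.exact_iff, LinearMap.ker_rangeRestrict, Submodule.range_subtype])]
  refine add_le_add ?_ (Module.length_le_of_injective _ (Submodule.injective_subtype _))
  rw [h.linearMap_ker_eq]
  exact Module.length_le_of_surjective _ f.surjective_rangeRestrict

lemma length_koszulHomology_le_add (f : M →ₗ[R] N) (g : N →ₗ[R] P) (hf : Function.Injective f)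
    (hg : Function.Surjective g) (h : Function.Exact f g) (i : ℕ) :
    Module.length R (koszulHomology N x i) ≤
      Module.length R (koszulHomology M x i) + Module.length R (koszulHomology P x i) :=
  length_le_add_of_exact _ _ ((ShortComplex.ShortExact.moduleCat_exact_iff_function_exact _).1
    ((koszulShortComplex_shortExact x f g hf hg h).homology_exact₂ i))

/-- The connecting map H_{i+1}(P) → H_i(M) is onto because its cokernel embeds in H_i(N) = 0. -/
lemma length_koszulHomology_le_succ (f : M →ₗ[R] N) (g : N →ₗ[R] P) (hf : Function.Injective f)
    (hg : Function.Surjective g) (h : Function.Exact f g) (i : ℕ)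
    (hN : Subsingleton (koszulHomology N x i)) :
    Module.length R (koszulHomology M x i) ≤ Module.length R (koszulHomology P x (i + 1)) := by
  have := length_le_add_of_exact _ _
    ((ShortComplex.ShortExact.moduleCat_exact_iff_function_exact _).1
      ((koszulShortComplex_shortExact x f g hf hg h).homology_exact₁ (i + 1) i rfl))
  refine this.trans ?_
  have h0 : Module.length R (koszulHomology N x i) = 0 := Module.length_eq_zero
  exact (add_le_add le_rfl h0.le).trans (add_zero _).le

variable (M) in
-- H_i is a subquotient of the Koszul term, a product of C(d, i) copies of `M`.
lemma length_koszulHomology_le (i : ℕ) :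
    Module.length R (koszulHomology M x i) ≤ d.choose i * Module.length R M := by
  have h1 : Module.length R (koszulHomology M x i) ≤
      Module.length R ((koszulComplex M x).cycles i) :=
    Module.length_le_of_surjective ((koszulComplex M x).homologyπ i).hom
      ((ModuleCat.epi_iff_surjective _).1 inferInstance)
  have h2 : Module.length R ((koszulComplex M x).cycles i) ≤ Module.length R (KoszulTerm d i M) :=
    Module.length_le_of_injective ((koszulComplex M x).iCycles i).hom
      ((ModuleCat.mono_iff_injective _).1 inferInstance)
  refine (h1.trans h2).trans ?_
  rw [Module.length_pi]
  simp

/-- The Koszul complex of `M` is exact in positive degrees, in terms of elements. -/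
def KoszulExact (M : Type v) [AddCommGroup M] [Module R M] : Prop :=
  ∀ (p : ℕ) (z : KoszulTerm d (p + 1) M), koszulDifferential M x p z = 0 →
    ∃ w : KoszulTerm d (p + 2) M, koszulDifferential M x (p + 1) w = z

lemma KoszulExact.subsingleton_koszulHomology (h : KoszulExact x M) (p : ℕ) :
    Subsingleton (koszulHomology M x (p + 1)) := by
  have : Limits.IsZero ((koszulComplex M x).homology (p + 1)) := by
    rw [← HomologicalComplex.exactAt_iff_isZero_homology,
      HomologicalComplex.exactAt_iff' _ (p + 2) (p + 1) p (by simp) (by simp),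
      ShortComplex.moduleCat_exact_iff]
    intro z hz
    obtain ⟨w, hw⟩ := h p z
      ((LinearMap.congr_fun (congrArg ModuleCat.Hom.hom (koszulComplex_d x M p)) z).symm.trans hz)
    exact ⟨w, (LinearMap.congr_fun
      (congrArg ModuleCat.Hom.hom (koszulComplex_d x M (p + 1))) w).trans hw⟩
  exact ModuleCat.subsingleton_of_isZero this

lemma KoszulExact.pi {ι : Type} {N : ι → Type v} [∀ k, AddCommGroup (N k)]
    [∀ k, Module R (N k)] (h : ∀ k, KoszulExact x (N k)) : KoszulExact x (∀ k, N k) := by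
  intro p z hz
  have hz' : ∀ k, koszulDifferential (N k) x p (fun S => z S k) = 0 := fun k => by
    refine (koszulDifferential_compLeft x (LinearMap.proj (R := R) (φ := N) k) p z).trans ?_
    rw [hz]
    rfl
  choose w hw using fun k => h k p _ (hz' k)
  refine ⟨fun S k => w k S, ?_⟩
  funext T k
  have := koszulDifferential_compLeft x (LinearMap.proj (R := R) (φ := N) k) (p + 1)
    (fun S k => w k S)
  exact (congrFun this T).symm.trans (congrFun (hw k) T)

/-- The extension by zero of an element of a Koszul term to a family indexed by all subsets. -/
def KoszulTerm.extend {p : ℕ} (m : KoszulTerm d p M) (S : Finset (Fin d)) : M :=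
  if h : S.card = p then m ⟨S, h⟩ else 0

lemma koszulDifferential_apply_extend (p : ℕ) (m : KoszulTerm d (p + 1) M)
    (T : {S : Finset (Fin d) // S.card = p}) :
    koszulDifferential M x p m T = ∑ i : Fin d,
      if i ∉ T.1 then koszulCoeff x T.1 i • KoszulTerm.extend m (insert i T.1) else 0 := by
  rw [koszulDifferential_apply]
  refine Finset.sum_congr rfl fun i _ => ?_
  by_cases h : i ∉ T.1
  · rw [dif_pos h, if_pos h, KoszulTerm.extend, dif_pos]
  · rw [dif_neg h, if_neg h]

/-- Wedging with `e_k` and dividing by `x_k` is a contracting homotopy, so a cycle `z` bounds `x_k⁻¹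
e_k ∧ z`. -/
lemma koszulExact_of_bijective_smul (k : Fin d)
    (hk : Function.Bijective (fun m : M => x k • m)) : KoszulExact x M := by
  intro p z hz
  choose inv hinv using hk.2
  simp only at hinv
  let ε (T : Finset (Fin d)) : R := (-1) ^ (T.filter (fun j => j < k)).card
  have hεε (T) : ε T * ε T = 1 := by
    simp only [ε, ← pow_add, ← two_mul, pow_mul]; simp
  have hε (T) : koszulCoeff x T k = ε T * x k := rfl
  have hεe (T) : ε (insert k T) = ε T := by
    simp only [ε, Finset.filter_insert, lt_irrefl, if_false]
  have hanti (U : Finset (Fin d)) (i : Fin d) (hkU : k ∉ U) (hiU : i ∉ U) (hik : i ≠ k) :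
      koszulCoeff x (insert k U) i * ε (insert i U) = - (ε U * koszulCoeff x U i) := by
    -- Replacing `x_k` by 1 isolates the signs, since `x_k` need not be cancellable in `R`.
    have := koszulCoeff_anticomm (Function.update x k 1) U hiU hkU hik
    simp only [koszulCoeff, Function.update_self, Function.update_of_ne hik, mul_one] at this
    linear_combination (norm := (simp only [koszulCoeff, ε]; ring)) (ε U * ε (insert i U)) * this
      - koszulCoeff x U i * ε U * hεε (insert i U)
      - koszulCoeff x (insert k U) i * ε (insert i U) * hεε U
  let w : KoszulTerm d (p + 2) M := fun S =>
    if k ∈ S.1 then ε S.1 • inv (KoszulTerm.extend z (S.1.erase k)) else 0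
  have hw (T : Finset (Fin d)) (i : Fin d) (hT : T.card = p + 1) (hi : i ∉ T) :
      x k • KoszulTerm.extend w (insert i T) = if k ∈ insert i T then
        ε (insert i T) • KoszulTerm.extend z ((insert i T).erase k) else 0 := by
    rw [KoszulTerm.extend, dif_pos (by rw [Finset.card_insert_of_notMem hi, hT])]
    simp only [w]
    split_ifs
    · rw [smul_comm, hinv]
    · rw [smul_zero]
  -- Multiplication by `x_k` is injective on `M`, so the identity may be checked after it, where the
  -- chosen inverses disappear.
  refine ⟨w, funext fun T => hk.1 ?_⟩
  have hzT : KoszulTerm.extend z T.1 = z T := dif_pos T.2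
  simp only [koszulDifferential_apply_extend, Finset.smul_sum, smul_ite, smul_zero]
  by_cases hkT : k ∈ T.1
  · have hkU : k ∉ T.1.erase k := Finset.notMem_erase k T.1
    -- The cycle condition at `T \ {k}` expresses `x_k z_T` through the remaining terms.
    have hzU := congrFun hz ⟨T.1.erase k, by rw [Finset.card_erase_of_mem hkT, T.2]; rfl⟩
    rw [koszulDifferential_apply_extend, Pi.zero_apply,
      ← Finset.add_sum_erase _ _ (Finset.mem_univ k), if_pos hkU, Finset.insert_erase hkT, hzT,
      hε] at hzU
    rw [← Finset.add_sum_erase _ _ (Finset.mem_univ k), if_neg (not_not.2 hkT), zero_add]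
    have hx : x k • z T = ε (T.1.erase k) • (ε (T.1.erase k) * x k) • z T := by
      rw [smul_smul, ← mul_assoc, hεε, one_mul]
    rw [hx, eq_neg_of_add_eq_zero_left hzU, smul_neg, Finset.smul_sum, ← Finset.sum_neg_distrib]
    refine Finset.sum_congr rfl fun i hi => ?_
    have hik : i ≠ k := Finset.ne_of_mem_erase hi
    by_cases hiT : i ∈ T.1
    · simp [hiT, hik]
    · have hiU : i ∉ T.1.erase k := fun h => hiT (Finset.mem_of_mem_erase h)
      rw [if_pos hiT, if_pos hiU, smul_comm, hw _ _ T.2 hiT,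
        if_pos (Finset.mem_insert_of_mem hkT), Finset.erase_insert_of_ne hik, smul_smul, smul_smul,
        ← neg_smul]
      congr 1
      rw [← hanti _ i hkU hiU hik, Finset.insert_erase hkT,
        ← hεe (insert i (T.1.erase k)), Finset.insert_comm, Finset.insert_erase hkT]
  -- If `k ∉ T`, only `i = k` yields a set containing `k`, where `w` can be nonzero.
  · rw [Finset.sum_eq_single k]
    · rw [if_pos hkT, smul_comm, hw _ _ T.2 hkT, if_pos (Finset.mem_insert_self _ _), hε, hεe,
        smul_smul, Finset.erase_insert hkT, hzT, mul_right_comm, hεε, one_mul]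
    · intro i _ hik
      split_ifs with hiT
      · rfl
      · rw [smul_comm, hw _ _ T.2 hiT, if_neg (by simp [hkT, hik.symm]), smul_zero]
    · simp

end KoszulFunctoriality

/-! ### The two definitions of Ext, and naturality of their identification -/

section ExtComparison

variable {R : Type u} [CommRing R] {X X' : ModuleCat.{u} R} (P : ProjectiveResolution X)
  (P' : ProjectiveResolution X') (Y : ModuleCat.{u} R)

/-- The functoriality of `Hom(-, Y)` on chain complexes. -/
def linearYonedaObjMap {K L : ChainComplex (ModuleCat.{u} R) ℕ} (φ : K ⟶ L)
    (Y : ModuleCat.{u} R) : L.linearYonedaObj R Y ⟶ K.linearYonedaObj R Y :=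
  (HomologicalComplex.unopFunctor _ _).map
    (((((linearYoneda R (ModuleCat.{u} R)).obj Y).rightOp.mapHomologicalComplex
      (ComplexShape.down ℕ)).map φ).op)

variable {P P'} in
lemma isoExt_hom_naturality {g : X' ⟶ X} (φ : P'.Hom P g) (n : ℕ) :
    ((Ext R (ModuleCat.{u} R) n).map g.op).app Y ≫ (P'.isoExt (R := R) n Y).hom =
      (P.isoExt (R := R) n Y).hom ≫
        HomologicalComplex.homologyMap (linearYonedaObjMap φ.hom Y) n := by
  have h1 := ProjectiveResolution.isoLeftDerivedObj_inv_naturality g P' P φ.hom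
    φ.hom_f_zero_comp_π_f_zero ((linearYoneda R (ModuleCat.{u} R)).obj Y).rightOp n
  have h2 := HomologicalComplex.homologyOp_hom_naturality (linearYonedaObjMap φ.hom Y) n
  have h1' := congrArg Quiver.Hom.unop h1
  have h2' := congrArg Quiver.Hom.unop ((Iso.eq_comp_inv _).2
    ((Category.assoc _ _ _).trans ((Iso.inv_comp_eq _).2 h2)))
  refine (congrArg (· ≫ (HomologicalComplex.homologyUnop _ n).inv) h1').trans ?_
  exact congrArg
    ((P.isoLeftDerivedObj ((linearYoneda R (ModuleCat.{u} R)).obj Y).rightOp n).inv.unop ≫ ·) h2'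

section ClassMap

variable (K L : CochainComplex (ModuleCat.{u} R) ℕ) (n : ℕ)

/-- A cocycle, as an element of the object of cycles. -/
def cocycleLift : ModuleCat.of R (LinearMap.ker (K.d n (n + 1)).hom) ⟶ K.cycles n :=
  K.liftCycles (ModuleCat.ofHom (LinearMap.ker (K.d n (n + 1)).hom).subtype) (n + 1) (by simp)
    (by ext z; exact z.2)

lemma iCycles_cocycleLift (z : LinearMap.ker (K.d n (n + 1)).hom) :
    K.iCycles n (cocycleLift K n z) = z.1 :=
  LinearMap.congr_fun (congrArg ModuleCat.Hom.hom (K.liftCycles_i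
    (ModuleCat.ofHom (LinearMap.ker (K.d n (n + 1)).hom).subtype) (n + 1) (by simp)
    (by ext z; exact z.2))) z

lemma iCycles_injective : Function.Injective (K.iCycles n) :=
  (ModuleCat.mono_iff_injective (K.iCycles n)).1 inferInstance

/-- The linear map sending a cocycle to its cohomology class. -/
def cocycleClass : LinearMap.ker (K.d n (n + 1)).hom →ₗ[R] K.homology n :=
  (cocycleLift K n ≫ K.homologyπ n).hom

lemma cocycleClass_surjective : Function.Surjective (cocycleClass K n) := by
  intro y
  obtain ⟨c, rfl⟩ := (ModuleCat.epi_iff_surjective (K.homologyπ n)).1 inferInstance y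
  refine ⟨⟨K.iCycles n c, ?_⟩, ?_⟩
  · exact LinearMap.congr_fun (congrArg ModuleCat.Hom.hom (K.iCycles_d n (n + 1))) c
  · exact congrArg (K.homologyπ n) (iCycles_injective K n (iCycles_cocycleLift K n _))

lemma cocycleClass_eq_zero_iff (z : LinearMap.ker (K.d n (n + 1)).hom) :
    cocycleClass K n z = 0 ↔ ∃ g, (K.d ((ComplexShape.up ℕ).prev n) n).hom g = z.1 := by
  have hex : (ShortComplex.mk (K.toCycles ((ComplexShape.up ℕ).prev n) n) (K.homologyπ n)
      (by simp)).Exact :=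
    ShortComplex.exact_of_g_is_cokernel _ (K.homologyIsCokernel _ n rfl)
  rw [ShortComplex.moduleCat_exact_iff] at hex
  have hto (g) : K.iCycles n (K.toCycles ((ComplexShape.up ℕ).prev n) n g) =
      (K.d ((ComplexShape.up ℕ).prev n) n).hom g :=
    LinearMap.congr_fun (congrArg ModuleCat.Hom.hom (K.toCycles_i _ _)) _
  constructor
  · intro hz
    obtain ⟨g, hg⟩ := hex _ hz
    refine ⟨g, ?_⟩
    rw [← hto]
    exact (congrArg (K.iCycles n) hg).trans (iCycles_cocycleLift K n z)
  · rintro ⟨g, hg⟩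
    refine (congrArg (K.homologyπ n) (iCycles_injective K n
      ((iCycles_cocycleLift K n z).trans (hg.symm.trans (hto g).symm)))).trans ?_
    exact LinearMap.congr_fun (congrArg ModuleCat.Hom.hom (K.toCycles_comp_homologyπ _ _)) g

variable {K L} in
lemma homologyMap_cocycleClass (ψ : K ⟶ L) (z : LinearMap.ker (K.d n (n + 1)).hom)
    (w : LinearMap.ker (L.d n (n + 1)).hom) (h : ψ.f n z.1 = w.1) :
    HomologicalComplex.homologyMap ψ n (cocycleClass K n z) = cocycleClass L n w := by
  have h1 := LinearMap.congr_fun (congrArg ModuleCat.Hom.hom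
    (HomologicalComplex.homologyπ_naturality ψ n)) (cocycleLift K n z)
  refine h1.trans (congrArg (L.homologyπ n) (iCycles_injective L n ?_))
  refine (LinearMap.congr_fun (congrArg ModuleCat.Hom.hom
    (HomologicalComplex.cyclesMap_i ψ n)) _).trans ?_
  exact (congrArg (ψ.f n) (iCycles_cocycleLift K n z)).trans
    (h.trans (iCycles_cocycleLift L n w).symm)

end ClassMap

/-- The linear map sending a cocycle on a projective resolution to its class in `Ext`. -/
def extClassMap (n : ℕ) :
    LinearMap.ker ((P.complex.linearYonedaObj R Y).d n (n + 1)).hom →ₗ[R] Abelian.Ext X Y n where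
  toFun f := P.extMk f.1 (n + 1) rfl f.2
  map_add' f g := (P.add_extMk f.1 g.1 (n + 1) rfl f.2 g.2).symm
  map_smul' r f := by
    rw [RingHom.id_apply, Abelian.Ext.smul_eq_comp_mk₀]
    refine Eq.trans ?_ (P.extMk_comp_mk₀ f.1 (n + 1) rfl f.2 (r • 𝟙 Y)).symm
    congr 1

lemma extClassMap_surjective (n : ℕ) : Function.Surjective (extClassMap P Y n) := by
  intro y
  obtain ⟨f, hf, rfl⟩ := P.extMk_surjective y (n + 1) rfl
  exact ⟨⟨f, hf⟩, rfl⟩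

open CochainComplex.HomComplex in
-- Degree 0 is treated apart: the resolution vanishes in cohomological degree 1, so there are no
-- nonzero coboundaries.
lemma extMk_zero_eq_zero_iff (f : P.complex.X 0 ⟶ Y) (hf : P.complex.d 1 0 ≫ f = 0) :
    P.extMk f 1 rfl hf = 0 ↔ f = 0 := by
  simp only [← P.extEquivCohomologyClass.apply_eq_iff_eq,
    ProjectiveResolution.extEquivCohomologyClass_extMk,
    ProjectiveResolution.extEquivCohomologyClass_zero, CohomologyClass.mk_eq_zero_iff]
  rw [Cocycle.toSingleMk_mem_coboundaries_iff _ _ _ _ _ 1 (by simp)]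
  have hX : Limits.IsZero (P.cochainComplex.X 1) :=
    CochainComplex.isZero_of_isStrictlyLE _ 0 _ (by simp)
  constructor
  · rintro ⟨g, hg⟩
    rw [hX.eq_of_src g 0, Limits.comp_zero] at hg
    rw [← cancel_epi (P.cochainComplexXIso (-(0 : ℕ)) 0 rfl).hom, ← hg, Limits.comp_zero]
  · rintro rfl
    exact ⟨0, by simp⟩

lemma extClassMap_eq_zero_iff (n : ℕ)
    (z : LinearMap.ker ((P.complex.linearYonedaObj R Y).d n (n + 1)).hom) :
    extClassMap P Y n z = 0 ↔
      ∃ g, ((P.complex.linearYonedaObj R Y).d ((ComplexShape.up ℕ).prev n) n).hom g = z.1 := by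
  rcases n with _ | n
  · refine (extMk_zero_eq_zero_iff P Y z.1 z.2).trans ?_
    -- `prev 0` is 0 by convention, and 0 → 0 is not a relation of the shape.
    have : (P.complex.linearYonedaObj R Y).d ((ComplexShape.up ℕ).prev 0) 0 = 0 :=
      HomologicalComplex.shape _ _ _ (by simp)
    rw [this]
    exact ⟨fun h => ⟨0, h.symm⟩, fun ⟨g, hg⟩ => hg.symm⟩
  · have : (ComplexShape.up ℕ).prev (n + 1) = n := by simp
    rw [this]
    exact P.extMk_eq_zero_iff z.1 (n + 2) rfl z.2 n rfl

lemma exists_linearEquiv_of_ker_eq {A B Z : Type*} [AddCommGroup A] [Module R A] [AddCommGroup B]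
    [Module R B] [AddCommGroup Z] [Module R Z] (f : Z →ₗ[R] A) (g : Z →ₗ[R] B)
    (hf : Function.Surjective f) (hg : Function.Surjective g) (h : ∀ z, f z = 0 ↔ g z = 0) :
    ∃ e : A ≃ₗ[R] B, ∀ z, e (f z) = g z := by
  have hk : LinearMap.ker f = LinearMap.ker g := Submodule.ext h
  refine ⟨(f.quotKerEquivOfSurjective hf).symm ≪≫ₗ Submodule.quotEquivOfEq _ _ hk ≪≫ₗ
    g.quotKerEquivOfSurjective hg, fun z => ?_⟩
  have : (f.quotKerEquivOfSurjective hf).symm (f z) = Submodule.Quotient.mk z := by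
    rw [LinearEquiv.symm_apply_eq]; rfl
  simp only [LinearEquiv.trans_apply, this]
  rfl

/-- Both sides are cocycles of `Hom(P, Y)` modulo coboundaries. Recording the value on classes of
cocycles is what makes naturality provable. -/
lemma exists_extEquiv (n : ℕ) : ∃ e : Abelian.Ext X Y n ≃ₗ[R]
    ((Ext R (ModuleCat.{u} R) n).obj (Opposite.op X)).obj Y,
    ∀ z, (P.isoExt (R := R) n Y).hom (e (extClassMap P Y n z)) =
      cocycleClass (P.complex.linearYonedaObj R Y) n z := by
  obtain ⟨e, he⟩ := exists_linearEquiv_of_ker_eq (extClassMap P Y n)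
    (cocycleClass (P.complex.linearYonedaObj R Y) n) (extClassMap_surjective P Y n)
    (cocycleClass_surjective _ n)
    (fun z => (extClassMap_eq_zero_iff P Y n z).trans (cocycleClass_eq_zero_iff _ n z).symm)
  refine ⟨e ≪≫ₗ (P.isoExt (R := R) n Y).toLinearEquiv.symm, fun z => ?_⟩
  rw [← he]
  exact (P.isoExt (R := R) n Y).toLinearEquiv.apply_symm_apply _

variable (X) in
/-- The linear equivalence between the two definitions of `Ext` in Mathlib. -/
def extEquiv (n : ℕ) : Abelian.Ext X Y n ≃ₗ[R]
    ((Ext R (ModuleCat.{u} R) n).obj (Opposite.op X)).obj Y :=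
  (exists_extEquiv (projectiveResolution X) Y n).choose

/-- On both sides `g` acts by precomposing a representing cocycle with a lift of `g` to the
resolutions. -/
lemma extEquiv_naturality (g : X' ⟶ X) (n : ℕ) (e : Abelian.Ext X Y n) :
    extEquiv X' Y n ((Abelian.Ext.mk₀ g).comp e (zero_add n)) =
      ((Ext R (ModuleCat.{u} R) n).map g.op).app Y (extEquiv X Y n e) := by
  obtain ⟨z, rfl⟩ := extClassMap_surjective (projectiveResolution X) Y n e
  let φ : (projectiveResolution X').Hom (projectiveResolution X) g :=
    ⟨ProjectiveResolution.lift g _ _, ProjectiveResolution.lift_commutes_zero g _ _⟩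
  have hw := HomologicalComplex.Hom.comm (linearYonedaObjMap φ.hom Y) n (n + 1)
  let w : LinearMap.ker (((projectiveResolution X').complex.linearYonedaObj R Y).d n (n + 1)).hom :=
    ⟨(linearYonedaObjMap φ.hom Y).f n z.1,
      (LinearMap.congr_fun (congrArg ModuleCat.Hom.hom hw) z.1).trans
        ((congrArg ((linearYonedaObjMap φ.hom Y).f (n + 1)) z.2).trans (map_zero _))⟩
  have h0 : (Abelian.Ext.mk₀ g).comp (extClassMap (projectiveResolution X) Y n z) (zero_add n) =
      extClassMap (projectiveResolution X') Y n w :=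
    ProjectiveResolution.mk₀_comp_extMk z.1 (n + 1) rfl z.2 φ
  rw [h0]
  apply ((projectiveResolution X').isoExt (R := R) n Y).toLinearEquiv.injective
  refine ((exists_extEquiv (projectiveResolution X') Y n).choose_spec w).trans ?_
  refine Eq.trans ?_ (LinearMap.congr_fun (congrArg ModuleCat.Hom.hom
    (isoExt_hom_naturality Y φ n)) _).symm
  refine Eq.trans ?_ (congrArg (HomologicalComplex.homologyMap (linearYonedaObjMap φ.hom Y) n)
    ((exists_extEquiv (projectiveResolution X) Y n).choose_spec z)).symm
  exact (homologyMap_cocycleClass n _ z w rfl).symm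

end ExtComparison

/-! ### Local cohomology as a direct limit of `Abelian.Ext` -/

section LocalCohomologyDirectLimit

variable {R : Type u} [CommRing R] (I : Ideal R)

/-- The projection `R / I ^ t → R / I ^ s` for `s ≤ t`. -/
def powQuotMap {s t : ℕ} (h : s ≤ t) :
    ModuleCat.of R (R ⧸ I ^ t) ⟶ ModuleCat.of R (R ⧸ I ^ s) :=
  ModuleCat.ofHom (Submodule.mapQ _ _ LinearMap.id (Ideal.pow_le_pow_right h))

lemma powQuotMap_self (t : ℕ) : powQuotMap I (le_refl t) = 𝟙 _ := by
  ext
  rfl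

lemma powQuotMap_comp {s t r : ℕ} (h : s ≤ t) (h' : t ≤ r) :
    powQuotMap I h' ≫ powQuotMap I h = powQuotMap I (h.trans h') := by
  ext
  rfl

variable (q : ℕ) (M : ModuleCat.{u} R)

/-- The transition maps of the direct system `Ext^q(R / I ^ t, M)`. -/
def extTransition (s t : ℕ) (h : s ≤ t) :
    Abelian.Ext (ModuleCat.of R (R ⧸ I ^ s)) M q →ₗ[R]
      Abelian.Ext (ModuleCat.of R (R ⧸ I ^ t)) M q :=
  (Abelian.Ext.mk₀ (powQuotMap I h)).precompOfLinear R M (zero_add q)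

lemma extTransition_apply {s t : ℕ} (h : s ≤ t) (e) :
    extTransition I q M s t h e = (Abelian.Ext.mk₀ (powQuotMap I h)).comp e (zero_add q) := rfl

instance extDirectedSystem :
    DirectedSystem (fun t => Abelian.Ext (ModuleCat.of R (R ⧸ I ^ t)) M q)
      (fun s t h => extTransition I q M s t h) where
  map_self t e := by
    rw [extTransition_apply, powQuotMap_self, Abelian.Ext.mk₀_id_comp]
  map_map r s t h h' e := by
    rw [extTransition_apply, extTransition_apply, extTransition_apply,
      Abelian.Ext.mk₀_comp_mk₀_assoc, powQuotMap_comp]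

/-- Local cohomology with support in `I`, as the direct limit of `Ext^q(R / I ^ t, M)`, with `Ext`
defined by the derived category. -/
def LC : Type u :=
  Module.DirectLimit (fun t => Abelian.Ext (ModuleCat.of R (R ⧸ I ^ t)) M q)
    (extTransition I q M)

namespace LC

instance : AddCommGroup (LC I q M) :=
  inferInstanceAs (AddCommGroup (Module.DirectLimit
    (fun t => Abelian.Ext (ModuleCat.of R (R ⧸ I ^ t)) M q) (extTransition I q M)))

instance : Module R (LC I q M) :=
  inferInstanceAs (Module R (Module.DirectLimit
    (fun t => Abelian.Ext (ModuleCat.of R (R ⧸ I ^ t)) M q) (extTransition I q M)))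

/-- The map from a term of the direct system to the direct limit. -/
def of (t : ℕ) : Abelian.Ext (ModuleCat.of R (R ⧸ I ^ t)) M q →ₗ[R] LC I q M :=
  Module.DirectLimit.of R ℕ _ (extTransition I q M) t

variable {I q M}

lemma exists_of (z : LC I q M) : ∃ t e, of I q M t e = z :=
  Module.DirectLimit.exists_of z

lemma of_transition {s t : ℕ} (h : s ≤ t) (e) :
    of I q M t (extTransition I q M s t h e) = of I q M s e :=
  Module.DirectLimit.of_f

lemma exists_transition_eq_zero {t : ℕ} {e} (h : of I q M t e = 0) :
    ∃ (s : ℕ) (hs : t ≤ s), extTransition I q M t s hs e = 0 :=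
  Module.DirectLimit.of.zero_exact h

/-- Linear maps out of local cohomology. -/
def lift {N : Type v} [AddCommGroup N] [Module R N]
    (g : ∀ t, Abelian.Ext (ModuleCat.of R (R ⧸ I ^ t)) M q →ₗ[R] N)
    (hg : ∀ s t h e, g t (extTransition I q M s t h e) = g s e) : LC I q M →ₗ[R] N :=
  Module.DirectLimit.lift R ℕ _ _ g hg

lemma lift_of {N : Type v} [AddCommGroup N] [Module R N]
    (g : ∀ t, Abelian.Ext (ModuleCat.of R (R ⧸ I ^ t)) M q →ₗ[R] N)
    (hg : ∀ s t h e, g t (extTransition I q M s t h e) = g s e) (t : ℕ) (e) :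
    lift g hg (of I q M t e) = g t e :=
  Module.DirectLimit.lift_of _ _ _

end LC

/-- The diagram whose colimit is local cohomology. -/
abbrev localCohomologyDiagram : ℕᵒᵖᵒᵖ ⥤ ModuleCat.{u} R :=
  localCohomology.diagram (localCohomology.idealPowersDiagram I) q ⋙ (evaluation _ _).obj M

/-- The colimit cocone that defines local cohomology. -/
def localCohomologyCocone : Limits.Cocone (localCohomologyDiagram I q M) :=
  ((evaluation _ _).obj M).mapCocone
    (Limits.colimit.cocone (localCohomology.diagram (localCohomology.idealPowersDiagram I) q))

/-- The defining cocone of local cohomology is a colimit cocone. -/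
def localCohomologyIsColimit : Limits.IsColimit (localCohomologyCocone I q M) :=
  Limits.isColimitOfPreserves ((evaluation _ _).obj M) (Limits.colimit.isColimit _)

/-- The comparison map to Mathlib's local cohomology. -/
def LC.toLocalCohomology : LC I q M →ₗ[R] (localCohomology I q).obj M :=
  LC.lift
    (fun t => ((localCohomologyCocone I q M).ι.app (Opposite.op (Opposite.op t))).hom ∘ₗ
      (extEquiv (ModuleCat.of R (R ⧸ I ^ t)) M q).toLinearMap) (by
    intro s t h e
    have h1 := extEquiv_naturality M (powQuotMap I h) q e
    refine (congrArg _ h1).trans ?_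
    exact LinearMap.congr_fun (congrArg ModuleCat.Hom.hom
      ((localCohomologyCocone I q M).w
        ((homOfLE h).op.op : Opposite.op (Opposite.op s) ⟶ Opposite.op (Opposite.op t)))) _)

lemma LC.toLocalCohomology_of (t : ℕ) (e) :
    LC.toLocalCohomology I q M (LC.of I q M t e) =
      (localCohomologyCocone I q M).ι.app (Opposite.op (Opposite.op t))
        (extEquiv (ModuleCat.of R (R ⧸ I ^ t)) M q e) :=
  LC.lift_of _ _ _ _

instance : Limits.PreservesFilteredColimitsOfSize.{0, 0} (forget (ModuleCat.{u} R)) :=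
  Limits.preservesFilteredColimitsOfSize_shrink.{0, u, 0, u} _

lemma exists_map_eq_zero_of_isColimit {J : Type} [SmallCategory J] [IsFiltered J]
    (F : J ⥤ ModuleCat.{u} R) {c : Limits.Cocone F} (hc : Limits.IsColimit c) {j : J}
    (x : F.obj j) (hx : c.ι.app j x = 0) : ∃ (k : J) (f : j ⟶ k), F.map f x = 0 := by
  obtain ⟨k, f, g, h⟩ := Limits.Concrete.isColimit_exists_of_rep_eq F hc x (0 : F.obj j)
    (by rw [hx, map_zero])
  exact ⟨k, f, by rw [h, map_zero]⟩

/-- Both sides are filtered colimits computed on elements, and `extEquiv` matches their terms and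
transition maps. -/
lemma LC.toLocalCohomology_bijective : Function.Bijective (LC.toLocalCohomology I q M) := by
  constructor
  · rw [injective_iff_map_eq_zero]
    intro z hz
    obtain ⟨t, e, rfl⟩ := LC.exists_of z
    rw [LC.toLocalCohomology_of] at hz
    obtain ⟨k, f, hf⟩ := exists_map_eq_zero_of_isColimit _ (localCohomologyIsColimit I q M) _ hz
    have h : t ≤ k.unop.unop := leOfHom f.unop.unop
    have h1 := extEquiv_naturality M (powQuotMap I h) q e
    have h2 : extTransition I q M t k.unop.unop h e = 0 :=
      (LinearEquiv.map_eq_zero_iff _).1 (h1.trans hf)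
    rw [← LC.of_transition h, h2, map_zero]
  · intro y
    obtain ⟨t, y, rfl⟩ := Limits.Concrete.isColimit_exists_rep _ (localCohomologyIsColimit I q M) y
    obtain ⟨e, rfl⟩ :=
      (extEquiv (ModuleCat.of R (R ⧸ I ^ t.unop.unop)) M q).surjective y
    exact ⟨LC.of I q M t.unop.unop e, LC.toLocalCohomology_of I q M _ e⟩

lemma LC.length_eq : Module.length R (LC I q M) =
    Module.length R ((localCohomology I q).obj M) :=
  (LinearEquiv.ofBijective _ (LC.toLocalCohomology_bijective I q M)).length_eq

end LocalCohomologyDirectLimit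

/-! ### Long exact sequence of local cohomology -/

section LongExactSequence

variable {R : Type u} [CommRing R] (I : Ideal R) (q : ℕ)

lemma extTransition_comp {M N : ModuleCat.{u} R} {n b : ℕ} (β : Abelian.Ext M N n)
    (hb : q + n = b) (s t : ℕ) (h : s ≤ t) :
    β.postcompOfLinear R (ModuleCat.of R (R ⧸ I ^ t)) hb ∘ₗ extTransition I q M s t h =
      extTransition I b N s t h ∘ₗ β.postcompOfLinear R (ModuleCat.of R (R ⧸ I ^ s)) hb :=
  LinearMap.ext fun e => Abelian.Ext.comp_assoc _ e β (zero_add q) hb (by omega)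

/-- The map `H^q(M) → H^b(N)` induced by a class in `Ext^n(M, N)`, where `q + n = b`. -/
def LC.postcomp {M N : ModuleCat.{u} R} {n b : ℕ} (β : Abelian.Ext M N n) (hb : q + n = b) :
    LC I q M →ₗ[R] LC I b N :=
  LC.lift (fun t => LC.of I b N t ∘ₗ β.postcompOfLinear R (ModuleCat.of R (R ⧸ I ^ t)) hb)
    fun s t h e => by
      refine Eq.trans ?_ (LC.of_transition h _)
      exact congrArg (LC.of I b N t) (LinearMap.congr_fun (extTransition_comp I q β hb s t h) e)

lemma LC.postcomp_of {M N : ModuleCat.{u} R} {n b : ℕ} (β : Abelian.Ext M N n) (hb : q + n = b)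
    (t : ℕ) (e) : LC.postcomp I q β hb (LC.of I q M t e) =
      LC.of I b N t (β.postcompOfLinear R (ModuleCat.of R (R ⧸ I ^ t)) hb e) :=
  LC.lift_of _ _ _ _

/-- Direct limits are exact: a class dying in the limit dies at a finite stage, where exactness for
Ext applies. -/
lemma LC.postcomp_exact {M N P : ModuleCat.{u} R} {n b n' c : ℕ} (β : Abelian.Ext M N n)
    (hb : q + n = b) (γ : Abelian.Ext N P n') (hc : b + n' = c)
    (h : ∀ X : ModuleCat.{u} R, Function.Exact (β.postcompOfLinear R X hb)
      (γ.postcompOfLinear R X hc)) :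
    Function.Exact (LC.postcomp I q β hb) (LC.postcomp I b γ hc) := by
  intro y
  constructor
  · intro hy
    obtain ⟨i, e, rfl⟩ := LC.exists_of y
    rw [LC.postcomp_of] at hy
    obtain ⟨j, hij, hj⟩ := LC.exists_transition_eq_zero hy
    obtain ⟨a, ha⟩ := (h _ (extTransition I b N i j hij e)).1
      ((LinearMap.congr_fun (extTransition_comp I b γ hc i j hij) e).trans hj)
    exact ⟨LC.of I q M j a, by rw [LC.postcomp_of, ha, LC.of_transition]⟩
  · rintro ⟨x, rfl⟩
    obtain ⟨i, e, rfl⟩ := LC.exists_of x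
    rw [LC.postcomp_of, LC.postcomp_of, (h _).apply_apply_eq_zero, map_zero]

/-- The map on local cohomology induced by a linear map. -/
def LC.map {M N : ModuleCat.{u} R} (f : M ⟶ N) : LC I q M →ₗ[R] LC I q N :=
  LC.postcomp I q (Abelian.Ext.mk₀ f) (add_zero q)

lemma LC.map_of {M N : ModuleCat.{u} R} (f : M ⟶ N) (t : ℕ)
    (e : Abelian.Ext (ModuleCat.of R (R ⧸ I ^ t)) M q) :
    LC.map I q f (LC.of I q M t e) =
      LC.of I q N t (e.comp (Abelian.Ext.mk₀ f) (add_zero q)) :=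
  LC.postcomp_of _ _ _ _ _ _

variable {S : ShortComplex (ModuleCat.{u} R)} (hS : S.ShortExact)

/-- The connecting map of local cohomology. -/
def LC.connecting : LC I q S.X₃ →ₗ[R] LC I (q + 1) S.X₁ :=
  LC.postcomp I q hS.extClass rfl

lemma ext_exact_connecting (X : ModuleCat.{u} R) :
    Function.Exact ((Abelian.Ext.mk₀ S.g).postcompOfLinear R X (add_zero q))
      (hS.extClass.postcompOfLinear R X (rfl : q + 1 = q + 1)) := fun e =>
  ⟨fun he => Abelian.Ext.covariant_sequence_exact₃ _ hS e rfl he, by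
    rintro ⟨a, rfl⟩
    refine (Abelian.Ext.comp_assoc_of_second_deg_zero a (Abelian.Ext.mk₀ S.g) hS.extClass
      rfl).trans ?_
    rw [hS.comp_extClass, Abelian.Ext.comp_zero]⟩

lemma ext_connecting_exact (X : ModuleCat.{u} R) :
    Function.Exact (hS.extClass.postcompOfLinear R X (rfl : q + 1 = q + 1))
      ((Abelian.Ext.mk₀ S.f).postcompOfLinear R X (add_zero (q + 1))) := fun e =>
  ⟨fun he => Abelian.Ext.covariant_sequence_exact₁ _ hS e he rfl, by
    rintro ⟨a, rfl⟩
    refine (Abelian.Ext.comp_assoc_of_third_deg_zero a hS.extClass (Abelian.Ext.mk₀ S.f)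
      rfl).trans ?_
    rw [hS.extClass_comp, Abelian.Ext.comp_zero]⟩

lemma LC.exact_connecting : Function.Exact (LC.map I q S.g) (LC.connecting I q hS) :=
  LC.postcomp_exact _ _ _ _ _ _ fun _ => ext_exact_connecting q hS _

lemma LC.connecting_exact :
    Function.Exact (LC.connecting I q hS) (LC.map I (q + 1) S.f) :=
  LC.postcomp_exact _ _ _ _ _ _ fun _ => ext_connecting_exact q hS _

lemma LC.subsingleton_of_ext (M : ModuleCat.{u} R)
    (h : ∀ t, Subsingleton (Abelian.Ext (ModuleCat.of R (R ⧸ I ^ t)) M q)) :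
    Subsingleton (LC I q M) := by
  refine subsingleton_of_forall_eq 0 fun z => ?_
  obtain ⟨t, e, rfl⟩ := LC.exists_of z
  rw [Subsingleton.elim e 0, map_zero]

lemma LC.subsingleton_of_injective (M : ModuleCat.{u} R) [Injective M] :
    Subsingleton (LC I (q + 1) M) :=
  LC.subsingleton_of_ext I _ M fun _ =>
    subsingleton_of_forall_eq 0 fun e => Abelian.Ext.eq_zero_of_injective e

lemma LC.length_le_of_subsingleton (hS : S.ShortExact) (h : Subsingleton (LC I q S.X₂)) :
    Module.length R (LC I q S.X₃) ≤ Module.length R (LC I (q + 1) S.X₁) := by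
  have := length_le_add_of_exact _ _ (LC.exact_connecting I q hS)
  rwa [Module.length_eq_zero (M := LC I q S.X₂), zero_add] at this

lemma LC.length_le_of_subsingleton_succ (hS : S.ShortExact) (h : Subsingleton (LC I (q + 1) S.X₁)) :
    Module.length R (LC I q S.X₃) ≤ Module.length R (LC I q S.X₂) := by
  have := length_le_add_of_exact _ _ (LC.exact_connecting I q hS)
  rwa [Module.length_eq_zero (M := LC I (q + 1) S.X₁), add_zero] at this

lemma LC.subsingleton_of_exact (hS : S.ShortExact) (h₃ : Subsingleton (LC I q S.X₃))
    (h₂ : Subsingleton (LC I (q + 1) S.X₂)) : Subsingleton (LC I (q + 1) S.X₁) := by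
  refine subsingleton_of_forall_eq 0 fun z => ?_
  obtain ⟨y, rfl⟩ := (LC.connecting_exact I q hS z).1 (Subsingleton.elim _ _)
  rw [Subsingleton.elim y 0, map_zero]

lemma LC.subsingleton_of_surjective (hS : S.ShortExact) (h₃ : Function.Surjective (LC.map I q S.g))
    (h₂ : Subsingleton (LC I (q + 1) S.X₂)) : Subsingleton (LC I (q + 1) S.X₁) := by
  refine subsingleton_of_forall_eq 0 fun z => ?_
  obtain ⟨y, rfl⟩ := (LC.connecting_exact I q hS z).1 (Subsingleton.elim _ _)
  obtain ⟨w, rfl⟩ := h₃ y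
  exact (LC.exact_connecting I q hS).apply_apply_eq_zero w

end LongExactSequence

/-! ### Torsion modules and their local cohomology -/

section Torsion

variable {R : Type u} [CommRing R] (I : Ideal R)

/-- The submodule of elements killed by a power of `I`. -/
def powTorsion (M : Type v) [AddCommGroup M] [Module R M] : Submodule R M where
  carrier := {m | ∃ t : ℕ, ∀ a ∈ I ^ t, a • m = 0}
  zero_mem' := ⟨0, fun a _ => smul_zero a⟩
  add_mem' := by
    rintro m m' ⟨t, ht⟩ ⟨t', ht'⟩
    refine ⟨max t t', fun a ha => ?_⟩
    rw [smul_add, ht a (Ideal.pow_le_pow_right (le_max_left _ _) ha),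
      ht' a (Ideal.pow_le_pow_right (le_max_right _ _) ha), add_zero]
  smul_mem' := by
    rintro r m ⟨t, ht⟩
    exact ⟨t, fun a ha => by rw [smul_comm, ht a ha, smul_zero]⟩

variable {I} in
lemma mem_powTorsion {M : Type v} [AddCommGroup M] [Module R M] {m : M} :
    m ∈ powTorsion I M ↔ ∃ t : ℕ, ∀ a ∈ I ^ t, a • m = 0 := Iff.rfl

/-- The map `R / I ^ t → M` sending `1` to an element killed by `I ^ t`. -/
def powQuotLift {M : ModuleCat.{u} R} (t : ℕ) (m : M) (h : ∀ a ∈ I ^ t, a • m = 0) :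
    ModuleCat.of R (R ⧸ I ^ t) ⟶ M :=
  ModuleCat.ofHom ((I ^ t).liftQ (LinearMap.toSpanSingleton R M m) fun a ha => h a ha)

lemma powQuot_hom_ext {M : ModuleCat.{u} R} {t : ℕ}
    {f g : ModuleCat.of R (R ⧸ I ^ t) ⟶ M}
    (h : f (Submodule.Quotient.mk (1 : R) : R ⧸ I ^ t) =
      g (Submodule.Quotient.mk (1 : R) : R ⧸ I ^ t)) : f = g := by
  refine ModuleCat.hom_ext (Submodule.linearMap_qext _ (LinearMap.ext_ring h))

lemma linearEquiv₀_mk₀ {X Y : ModuleCat.{u} R} (f : X ⟶ Y) :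
    Abelian.Ext.linearEquiv₀ (R := R) (Abelian.Ext.mk₀ f) = f :=
  Abelian.Ext.linearEquiv₀.apply_symm_apply f

/-- Evaluation at `1`, from `H^0` to the module. -/
def LC.evalOne (M : ModuleCat.{u} R) : LC I 0 M →ₗ[R] M :=
  LC.lift
    (fun t => LinearMap.applyₗ (Submodule.Quotient.mk (1 : R) : R ⧸ I ^ t) ∘ₗ
      (ModuleCat.homLinearEquiv (S := R)).toLinearMap ∘ₗ
      (Abelian.Ext.linearEquiv₀ (R := R)).toLinearMap) (by
    intro s t h e
    obtain ⟨f, rfl⟩ := (Abelian.Ext.mk₀_bijective _ _).2 e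
    rw [extTransition_apply, Abelian.Ext.mk₀_comp_mk₀]
    simp only [LinearMap.comp_apply, LinearEquiv.coe_coe, linearEquiv₀_mk₀]
    rfl)

/-- An element killed by `I ^ t` is the value at 1 of a map `R / I ^ t → M`, so the torsion lies in
the range of `LC.evalOne`. -/
lemma length_powTorsion_le (M : ModuleCat.{u} R) :
    Module.length R (powTorsion I M) ≤ Module.length R (LC I 0 M) := by
  have h : powTorsion I M ≤ LinearMap.range (LC.evalOne I M) := by
    rintro m ⟨t, ht⟩
    refine ⟨LC.of I 0 M t (Abelian.Ext.mk₀ (powQuotLift I t m ht)), ?_⟩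
    refine (LC.lift_of _ _ _ _).trans ?_
    simp only [LinearMap.comp_apply, LinearEquiv.coe_coe, linearEquiv₀_mk₀]
    exact one_smul R m
  exact (Module.length_le_of_injective (Submodule.inclusion h)
    (Submodule.inclusion_injective h)).trans
    (Module.length_le_of_surjective _ (LC.evalOne I M).surjective_rangeRestrict)

lemma LC.map_surjective_of_torsion {M N : ModuleCat.{u} R} (f : M ⟶ N)
    (hf : Function.Surjective f) (hM : powTorsion I M = ⊤) :
    Function.Surjective (LC.map I 0 f) := by
  intro z
  obtain ⟨t, e, rfl⟩ := LC.exists_of z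
  obtain ⟨g, rfl⟩ := (Abelian.Ext.mk₀_bijective _ _).2 e
  obtain ⟨m, hm⟩ := hf (g (Submodule.Quotient.mk (1 : R) : R ⧸ I ^ t))
  obtain ⟨s, hs⟩ := mem_powTorsion.1 (hM.ge (Submodule.mem_top : m ∈ ⊤))
  have hs' : ∀ a ∈ I ^ (max s t), a • m = 0 :=
    fun a ha => hs a (Ideal.pow_le_pow_right (le_max_left _ _) ha)
  refine ⟨LC.of I 0 M (max s t) (Abelian.Ext.mk₀ (powQuotLift I _ m hs')), ?_⟩
  rw [LC.map_of, Abelian.Ext.mk₀_comp_mk₀, ← LC.of_transition (le_max_right s t),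
    extTransition_apply, Abelian.Ext.mk₀_comp_mk₀]
  congr 2
  apply powQuot_hom_ext
  refine Eq.trans ?_ hm
  change f ((1 : R) • m) = _
  rw [one_smul]

lemma powTorsion_powTorsion (M : Type v) [AddCommGroup M] [Module R M] :
    powTorsion I (powTorsion I M) = ⊤ := by
  rw [eq_top_iff]
  rintro ⟨m, t, ht⟩ -
  exact ⟨t, fun a ha => Subtype.ext (ht a ha)⟩

lemma powTorsion_eq_top_of_surjective {M N : Type v} [AddCommGroup M] [Module R M]
    [AddCommGroup N] [Module R N] (f : M →ₗ[R] N) (hf : Function.Surjective f)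
    (hM : powTorsion I M = ⊤) : powTorsion I N = ⊤ := by
  rw [eq_top_iff]
  intro n _
  obtain ⟨m, rfl⟩ := hf n
  obtain ⟨t, ht⟩ := mem_powTorsion.1 (hM.ge (Submodule.mem_top : m ∈ ⊤))
  exact ⟨t, fun a ha => by rw [← map_smul, ht a ha, map_zero]⟩

lemma exists_pow_smul_eq_zero_of_fg {M : Type v} [AddCommGroup M] [Module R M]
    (N : Submodule R M) (hN : N.FG) (h : N ≤ powTorsion I M) :
    ∃ t : ℕ, ∀ a ∈ I ^ t, ∀ n ∈ N, a • n = 0 := by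
  obtain ⟨s, rfl⟩ := hN
  choose t ht using fun m : s => mem_powTorsion.1 (h (Submodule.subset_span m.2))
  refine ⟨s.attach.sup t, fun a ha n hn => ?_⟩
  have : Submodule.span R (s : Set M) ≤ Submodule.torsionBy R M a := by
    refine Submodule.span_le.2 fun m hm => ?_
    exact ht ⟨m, hm⟩ a (Ideal.pow_le_pow_right (Finset.le_sup (Finset.mem_attach s ⟨m, hm⟩)) ha)
  exact this hn

/-- Over a Noetherian ring the torsion submodule of an injective module is injective. -/
lemma injective_powTorsion [IsNoetherianRing R] (E : Type u) [AddCommGroup E] [Module R E]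
    [hE : Module.Injective R E] : Module.Injective R (powTorsion I E) := by
  refine Module.Baer.injective fun J f => ?_
  obtain ⟨t, ht⟩ := exists_pow_smul_eq_zero_of_fg I
    (LinearMap.range ((powTorsion I E).subtype ∘ₗ f))
    (by
      rw [LinearMap.range_eq_map]
      exact (IsNoetherian.noetherian (⊤ : Submodule R J)).map _)
    (by rintro _ ⟨j, rfl⟩; exact (f j).2)
  -- Artin–Rees: `J ∩ I ^ (k + t) ⊆ I ^ t J`, which `f` kills. So `f` factors through `J / (J ∩ I ^
  -- (k + t))`, and extending from there to `R / I ^ (k + t)` keeps the values torsion.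
  obtain ⟨k, hk⟩ := Ideal.exists_pow_inf_eq_pow_smul I (M := R) J
  have hle : ∀ j : J, j.1 ∈ I ^ (k + t) → f j = 0 := by
    intro j hj
    have h1 : j.1 ∈ I ^ t • J := by
      have h2 := hk (k + t) (Nat.le_add_right _ _)
      rw [Nat.add_sub_cancel_left] at h2
      have h3 : j.1 ∈ I ^ (k + t) • (⊤ : Submodule R R) ⊓ J :=
        ⟨by simpa using hj, j.2⟩
      rw [h2] at h3
      exact Submodule.smul_mono le_rfl inf_le_right h3
    have h4 : I ^ t • J ≤ (LinearMap.ker f).map (Submodule.subtype J) := by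
      refine Submodule.smul_le.2 fun a ha n hn => ⟨a • (⟨n, hn⟩ : J), ?_, rfl⟩
      exact (map_smul f a _).trans (Subtype.ext (ht a ha _ ⟨⟨n, hn⟩, rfl⟩))
    obtain ⟨j', hj', hjj⟩ := h4 h1
    exact Subtype.ext hjj ▸ hj'
  let K : Submodule R J := Submodule.comap (Submodule.subtype J) (I ^ (k + t))
  obtain ⟨h, hh⟩ := hE.out (K.mapQ (I ^ (k + t)) (Submodule.subtype J) le_rfl)
    (by
      rw [← LinearMap.ker_eq_bot, Submodule.ker_mapQ]
      exact Submodule.mkQ_map_self K)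
    (K.liftQ ((powTorsion I E).subtype ∘ₗ f) fun j hj => by
      simp [hle j hj])
  refine ⟨(h ∘ₗ (I ^ (k + t)).mkQ).codRestrict _ fun r => ⟨k + t, fun a ha => ?_⟩, fun r hr => ?_⟩
  · rw [← map_smul]
    refine (congrArg h ?_).trans (map_zero h)
    exact (Submodule.Quotient.mk_eq_zero _).2 ((I ^ (k + t)).mul_mem_right r ha)
  · exact Subtype.ext (hh (K.mkQ ⟨r, hr⟩))

lemma exists_torsion_injective_embedding [IsNoetherianRing R] (M : ModuleCat.{u} R)
    (hM : powTorsion I M = ⊤) : ∃ (E C : ModuleCat.{u} R) (f : M ⟶ E) (g : E ⟶ C) (w : f ≫ g = 0),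
      (ShortComplex.mk f g w).ShortExact ∧ Injective E ∧ powTorsion I E = ⊤ ∧
        powTorsion I C = ⊤ ∧ Function.Surjective g := by
  obtain ⟨⟨E, hE, i, hi⟩⟩ := EnoughInjectives.presentation M
  have hE' : Module.Injective R E := (Module.injective_iff_injective_object R E).2 hE
  let j : M →ₗ[R] powTorsion I E := i.hom.codRestrict _ fun m => by
    obtain ⟨t, ht⟩ := mem_powTorsion.1 (hM.ge (Submodule.mem_top : m ∈ ⊤))
    exact ⟨t, fun a ha => by rw [← map_smul, ht a ha, map_zero]⟩
  have hj : Function.Injective j := fun a b hab =>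
    (ModuleCat.mono_iff_injective i).1 hi (congrArg Subtype.val hab)
  have hw : ModuleCat.ofHom j ≫ ModuleCat.ofHom (LinearMap.range j).mkQ = 0 :=
    ModuleCat.hom_ext (LinearMap.range_mkQ_comp j)
  exact ⟨ModuleCat.of R (powTorsion I E), ModuleCat.of R (powTorsion I E ⧸ LinearMap.range j),
    ModuleCat.ofHom j, ModuleCat.ofHom (LinearMap.range j).mkQ, hw,
    ModuleCat.shortComplex_shortExact _ (LinearMap.exact_map_mkQ_range j) hj
      (Submodule.mkQ_surjective _),
    (Module.injective_iff_injective_object R _).1 (injective_powTorsion I E),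
    powTorsion_powTorsion I E,
    powTorsion_eq_top_of_surjective I _ (Submodule.mkQ_surjective _) (powTorsion_powTorsion I E),
    Submodule.mkQ_surjective _⟩

/-- Dimension shifting along an embedding into a torsion injective, whose quotient is again torsion.
In degree 1, the map on H^0 onto that quotient is surjective, so the connecting map is zero. -/
lemma LC.subsingleton_of_torsion [IsNoetherianRing R] (q : ℕ) (M : ModuleCat.{u} R)
    (hM : powTorsion I M = ⊤) : Subsingleton (LC I (q + 1) M) := by
  induction q generalizing M with
  | zero =>
    obtain ⟨E, C, f, g, w, hS, hE, hTE, hTC, hg⟩ := exists_torsion_injective_embedding I M hM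
    have h1 : Function.Surjective (LC.map I 0 g) := LC.map_surjective_of_torsion I g hg hTE
    have h2 : Subsingleton (LC I (0 + 1) E) := LC.subsingleton_of_injective I 0 E
    exact LC.subsingleton_of_surjective I 0 (S := ShortComplex.mk f g w) hS h1 h2
  | succ q ih =>
    obtain ⟨E, C, f, g, w, hS, hE, hTE, hTC, hg⟩ := exists_torsion_injective_embedding I M hM
    exact LC.subsingleton_of_exact I (q + 1) (S := ShortComplex.mk f g w) hS (ih C hTC)
      (LC.subsingleton_of_injective I (q + 1) E)

end Torsion

/-! ### Bounding Koszul homology by local cohomology -/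

section LengthBound

variable {R : Type u} [CommRing R] (I : Ideal R)

/-- Multiplication by `r` on Ext is zero through `X` and invertible through `Y`. -/
lemma ext_subsingleton_of_isIso_smul (X Y : ModuleCat.{u} R) (r : R)
    (hX : ∀ a : X, r • a = 0) (hY : Function.Bijective (fun y : Y => r • y)) (q : ℕ) :
    Subsingleton (Abelian.Ext X Y q) := by
  have hX' : r • 𝟙 X = 0 := ModuleCat.hom_ext (LinearMap.ext hX)
  have hiso : IsIso (r • 𝟙 Y) := (ConcreteCategory.isIso_iff_bijective _).2 hY
  refine subsingleton_of_forall_eq 0 fun e => ?_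
  have h1 : r • e = 0 := by
    have h2 : (Abelian.Ext.mk₀ (r • 𝟙 X)).comp e (zero_add q) = r • e := by
      rw [Abelian.Ext.mk₀_smul, Abelian.Ext.smul_comp, Abelian.Ext.mk₀_id_comp]
    rw [← h2, hX', Abelian.Ext.mk₀_zero, Abelian.Ext.zero_comp]
  rw [Abelian.Ext.smul_eq_comp_mk₀] at h1
  have h3 := congrArg
    (fun z => Abelian.Ext.comp z (Abelian.Ext.mk₀ (inv (r • 𝟙 Y))) (add_zero q)) h1
  simpa only [Abelian.Ext.comp_assoc_of_third_deg_zero, Abelian.Ext.mk₀_comp_mk₀,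
    IsIso.hom_inv_id, Abelian.Ext.comp_mk₀_id, Abelian.Ext.zero_comp] using h3

lemma ext_pi_subsingleton {ι : Type} [Fintype ι] [DecidableEq ι] (X : ModuleCat.{u} R)
    (N : ι → Type u) [∀ k, AddCommGroup (N k)] [∀ k, Module R (N k)] (q : ℕ)
    (h : ∀ k, Subsingleton (Abelian.Ext X (ModuleCat.of R (N k)) q)) :
    Subsingleton (Abelian.Ext X (ModuleCat.of R (∀ k, N k)) q) := by
  refine subsingleton_of_forall_eq 0 fun e => ?_
  have hid : 𝟙 (ModuleCat.of R (∀ k, N k)) = ∑ k, ModuleCat.ofHom (LinearMap.proj (R := R) k) ≫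
      ModuleCat.ofHom (LinearMap.single R N k) := by
    refine ModuleCat.hom_ext (LinearMap.ext fun z => ?_)
    simp only [ModuleCat.hom_sum, ModuleCat.hom_comp, LinearMap.sum_apply]
    exact (LinearMap.sum_single_apply N z).symm
  rw [← Abelian.Ext.comp_mk₀_id e, hid, Abelian.Ext.mk₀_sum, Abelian.Ext.comp_sum]
  refine Finset.sum_eq_zero fun k _ => ?_
  rw [← Abelian.Ext.mk₀_comp_mk₀, ← Abelian.Ext.comp_assoc_of_third_deg_zero,
    Subsingleton.elim (e.comp _ _) 0, Abelian.Ext.zero_comp]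

variable {d : ℕ} (x : Fin d → R)

/-- The product of the localizations of `M` at the elements of the sequence `x`. -/
abbrev LocalizedPi (M : Type u) [AddCommGroup M] [Module R M] : Type u :=
  ∀ k : Fin d, LocalizedModule (Submonoid.powers (x k)) M

/-- The canonical map from `M` to the product of its localizations. -/
def toLocalizedPi (M : Type u) [AddCommGroup M] [Module R M] : M →ₗ[R] LocalizedPi x M :=
  LinearMap.pi fun k => LocalizedModule.mkLinearMap (Submonoid.powers (x k)) M

lemma bijective_smul_localizedModule (M : Type u) [AddCommGroup M] [Module R M] (r : R) (t : ℕ) :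
    Function.Bijective (fun m : LocalizedModule (Submonoid.powers r) M => r ^ t • m) :=
  (Module.End.isUnit_iff _).1 (IsLocalizedModule.map_units
    (LocalizedModule.mkLinearMap (Submonoid.powers r) M) (⟨r ^ t, t, rfl⟩ : Submonoid.powers r))

lemma koszulExact_localizedPi (M : Type u) [AddCommGroup M] [Module R M] :
    KoszulExact x (LocalizedPi x M) :=
  KoszulExact.pi x fun k => koszulExact_of_bijective_smul x k
    (by simpa using bijective_smul_localizedModule M (x k) 1)

lemma LC.subsingleton_localizedPi (hx : ∀ k, x k ∈ I) (q : ℕ) (M : Type u) [AddCommGroup M]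
    [Module R M] : Subsingleton (LC I q (ModuleCat.of R (LocalizedPi x M))) := by
  refine LC.subsingleton_of_ext I q _ fun t => ext_pi_subsingleton _ _ q fun k => ?_
  refine ext_subsingleton_of_isIso_smul _ _ (x k ^ t) (fun a => ?_)
    (bijective_smul_localizedModule M (x k) t) q
  obtain ⟨r, rfl⟩ := Submodule.Quotient.mk_surjective _ a
  exact (Submodule.Quotient.mk_eq_zero _).2
    ((I ^ t).mul_mem_right r (Ideal.pow_mem_pow (hx k) t))

/-- A power of each `x_k` annihilates such an element, so `I` lies in the radical of its
annihilator; finite generation gives a single power of `I`. -/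
lemma ker_toLocalizedPi_le (hI : I ≤ (Ideal.span (Set.range x)).radical) (hfg : I.FG)
    (M : Type u) [AddCommGroup M] [Module R M] :
    LinearMap.ker (toLocalizedPi x M) ≤ powTorsion I M := by
  intro m hm
  have h1 : Ideal.span (Set.range x) ≤ (Ideal.torsionOf R M m).radical := by
    refine Ideal.span_le.2 ?_
    rintro _ ⟨k, rfl⟩
    have h2 : LocalizedModule.mkLinearMap (Submonoid.powers (x k)) M m = 0 := congrFun hm k
    rw [IsLocalizedModule.eq_zero_iff (Submonoid.powers (x k))] at h2
    obtain ⟨⟨_, n, rfl⟩, hn⟩ := h2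
    exact ⟨n, hn⟩
  obtain ⟨t, ht⟩ := Ideal.exists_pow_le_of_le_radical_of_fg
    (hI.trans (Ideal.radical_le_radical_iff.2 h1)) hfg
  exact ⟨t, fun a ha => ht ha⟩

lemma LC.length_le_of_exact {A B C : Type u} [AddCommGroup A] [Module R A] [AddCommGroup B]
    [Module R B] [AddCommGroup C] [Module R C] (q : ℕ) (f : A →ₗ[R] B) (g : B →ₗ[R] C)
    (hf : Function.Injective f) (hg : Function.Surjective g) (h : Function.Exact f g)
    (hB : Subsingleton (LC I q (ModuleCat.of R B))) :
    Module.length R (LC I q (ModuleCat.of R C)) ≤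
      Module.length R (LC I (q + 1) (ModuleCat.of R A)) :=
  LC.length_le_of_subsingleton I q (S := ShortComplex.mk (ModuleCat.ofHom f) (ModuleCat.ofHom g)
    (ModuleCat.hom_ext h.linearMap_comp_eq_zero)) (ModuleCat.shortComplex_shortExact _ h hf hg) hB

lemma LC.length_le_of_exact_succ {A B C : Type u} [AddCommGroup A] [Module R A] [AddCommGroup B]
    [Module R B] [AddCommGroup C] [Module R C] (q : ℕ) (f : A →ₗ[R] B) (g : B →ₗ[R] C)
    (hf : Function.Injective f) (hg : Function.Surjective g) (h : Function.Exact f g)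
    (hA : Subsingleton (LC I (q + 1) (ModuleCat.of R A))) :
    Module.length R (LC I q (ModuleCat.of R C)) ≤ Module.length R (LC I q (ModuleCat.of R B)) :=
  LC.length_le_of_subsingleton_succ I q
    (S := ShortComplex.mk (ModuleCat.ofHom f) (ModuleCat.ofHom g)
      (ModuleCat.hom_ext h.linearMap_comp_eq_zero))
    (ModuleCat.shortComplex_shortExact _ h hf hg) hA

/-- Koszul homology in positive degrees is bounded by local cohomology below the length of the
sequence. -/
theorem length_koszulHomology_le_sum [IsNoetherianRing R] (hx : ∀ k, x k ∈ I)
    (hI : I ≤ (Ideal.span (Set.range x)).radical) (M : Type u) [AddCommGroup M] [Module R M]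
    (p : ℕ) : Module.length R (koszulHomology M x (p + 1)) ≤
      ∑ q ∈ Finset.range (d - p),
        (d.choose (p + 1 + q) : ℕ∞) * Module.length R (LC I q (ModuleCat.of R M)) := by
  -- `M` must vary over all modules: the cokernel to which the hypothesis applies need not be
  -- finitely generated.
  induction hn : d - p generalizing p M with
  | zero =>
    refine (length_koszulHomology_le x M (p + 1)).trans ?_
    rw [Nat.choose_eq_zero_of_lt (by omega)]
    simp
  | succ n ih =>
    let f := toLocalizedPi x M
    have hker : LinearMap.ker f ≤ powTorsion I M :=
      ker_toLocalizedPi_le I x hI (IsNoetherian.noetherian I) M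
    have hkert : powTorsion I (LinearMap.ker f) = ⊤ := by
      rw [eq_top_iff]
      rintro ⟨m, hm⟩ -
      obtain ⟨t, ht⟩ := hker hm
      exact ⟨t, fun a ha => Subtype.ext (ht a ha)⟩
    have hex1 : Function.Exact (LinearMap.ker f).subtype f.rangeRestrict := by
      rw [LinearMap.exact_iff, LinearMap.ker_rangeRestrict, Submodule.range_subtype]
    have hex2 : Function.Exact (LinearMap.range f).subtype (LinearMap.range f).mkQ :=
      LinearMap.exact_subtype_mkQ _
    have hLC (q : ℕ) :
        Module.length R (LC I q (ModuleCat.of R (LocalizedPi x M ⧸ LinearMap.range f))) ≤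
          Module.length R (LC I (q + 1) (ModuleCat.of R M)) :=
      (LC.length_le_of_exact I q _ _ Subtype.val_injective (Submodule.mkQ_surjective _) hex2
        (LC.subsingleton_localizedPi I x hx q M)).trans
        (LC.length_le_of_exact_succ I (q + 1) _ _ Subtype.val_injective
          f.surjective_rangeRestrict hex1
          (LC.subsingleton_of_torsion I (q + 1) (ModuleCat.of R (LinearMap.ker f)) hkert))
    have h1 := length_koszulHomology_le_add x _ _ Subtype.val_injective
      f.surjective_rangeRestrict hex1 (p + 1)
    have h2 : Module.length R (koszulHomology (LinearMap.ker f) x (p + 1)) ≤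
        (d.choose (p + 1) : ℕ∞) * Module.length R (LC I 0 (ModuleCat.of R M)) :=
      (length_koszulHomology_le x _ (p + 1)).trans (mul_le_mul_right
        ((Module.length_le_of_injective _ (Submodule.inclusion_injective hker)).trans
          (length_powTorsion_le I (ModuleCat.of R M))) _)
    have h3 := length_koszulHomology_le_succ x _ _ Subtype.val_injective
      (Submodule.mkQ_surjective _) hex2 (p + 1)
      ((koszulExact_localizedPi x M).subsingleton_koszulHomology x p)
    have h4 := h3.trans (ih (LocalizedPi x M ⧸ LinearMap.range f) (p + 1) (by omega))
    refine h1.trans ?_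
    -- The q = 0 term pays for the kernel; the others, shifted by one, pay for the cokernel.
    rw [Finset.sum_range_succ', add_comm]
    refine add_le_add (h4.trans (Finset.sum_le_sum fun q _ => ?_)) h2
    rw [show p + 1 + 1 + q = p + 1 + (q + 1) by ring]
    exact mul_le_mul_right (hLC q) _

end LengthBound

/-! ### Existence of a system of parameters -/

section SystemOfParameters

lemma exists_isSystemOfParameters {R : Type u} [CommRing R] [IsNoetherianRing R] [IsLocalRing R]
    {d : ℕ} (hd : ringKrullDim R = d) : ∃ x : Fin d → R, IsSystemOfParameters x := by
  obtain ⟨s, hs, hcard⟩ :=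
    (IsLocalRing.maximalIdeal R).exists_finset_card_eq_height_of_isNoetherianRing
  have hc : s.card = d := by
    have h := IsLocalRing.maximalIdeal_height_eq_ringKrullDim (R := R)
    rw [hd, ← hcard] at h
    exact_mod_cast h
  let e : Fin d ≃ s := (finCongr hc.symm).trans s.equivFin.symm
  have hr : Set.range (fun i => (e i : R)) = s := by
    rw [show (fun i => (e i : R)) = Subtype.val ∘ e from rfl, Set.range_comp, e.surjective.range_eq]
    simp
  refine ⟨fun i => e i, hd, ?_⟩
  rw [hr]
  have hle : Ideal.span (s : Set R) ≤ IsLocalRing.maximalIdeal R := hs.1.2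
  refine le_antisymm ((Ideal.IsPrime.radical_le_iff inferInstance).2 hle) ?_
  rw [Ideal.radical_eq_sInf]
  refine le_sInf fun J hJ => ?_
  -- The maximal ideal is minimal over `s`, hence the only prime containing `s`.
  exact hs.2 ⟨hJ.2, hJ.1⟩ (IsLocalRing.le_maximalIdeal hJ.2.ne_top)

end SystemOfParameters

/-! ### Rank versus number of generators -/

section Rank

lemma finrank_le_spanFinrank (R : Type u) [CommRing R] [IsDomain R] (M : Type v) [AddCommGroup M]
    [Module R M] [Module.Finite R M] :
    Module.finrank R M ≤ (⊤ : Submodule R M).spanFinrank := by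
  have h := Submodule.rank_le_spanRank (R := R) (M := M)
  rw [(Module.Finite.fg_top (R := R) (M := M)).spanRank_eq_spanFinrank,
    ← Module.finrank_eq_rank] at h
  exact_mod_cast h

end Rank

end LimCM

end

/-! ### The main theorem -/

open LimCM in
theorem mainTheorem6 {R : Type u} [CommRing R] [IsDomain R] [IsNoetherianRing R] [IsLocalRing R]
    (d : ℕ) (hd : ringKrullDim R = d)
    (M : ℕ → Type u) [∀ n, AddCommGroup (M n)] [∀ n, Module R (M n)]
    [∀ n, Module.Finite R (M n)]
    (hdim : ∀ n, Module.supportDim R (M n) = d)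
    (hfin : ∀ n, ∀ j < d, IsFiniteLength R
      ((localCohomology (IsLocalRing.maximalIdeal R) j).obj (ModuleCat.of R (M n))))
    (hlittle : ∀ j < d,
      (fun n => ((Module.length R
          ((localCohomology (IsLocalRing.maximalIdeal R) j).obj
            (ModuleCat.of R (M n)))).toNat : ℝ)) =o[atTop]
        (fun n => (Module.finrank R (M n) : ℝ))) :
    LimCM.IsLimCohenMacaulay R M ∧ LimCM.IsWeaklyLimCohenMacaulay R M := by
  obtain ⟨x, hx⟩ := exists_isSystemOfParameters hd
  have hmem : ∀ k, x k ∈ IsLocalRing.maximalIdeal R := fun k =>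
    hx.2 ▸ Ideal.le_radical (Ideal.subset_span ⟨k, rfl⟩)
  have hbound (p n : ℕ) := length_koszulHomology_le_sum (IsLocalRing.maximalIdeal R) x hmem
    hx.2.ge (M n) p
  simp only [LC.length_eq] at hbound
  -- Finiteness is needed before passing to real numbers, since `toNat` sends `⊤` to 0.
  have hne (p n : ℕ) : ∑ q ∈ Finset.range (d - p), (d.choose (p + 1 + q) : ℕ∞) *
      Module.length R ((localCohomology (IsLocalRing.maximalIdeal R) q).obj
        (ModuleCat.of R (M n))) ≠ ⊤ := by
    refine (ENat.sum_lt_top.2 fun q hq => ?_).ne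
    exact WithTop.mul_lt_top (ENat.natCast_lt_top _) (lt_top_iff_ne_top.2 (Module.length_ne_top_iff.2
      (hfin n q (by have := Finset.mem_range.1 hq; omega))))
  have hKfin (p n : ℕ) : IsFiniteLength R (koszulHomology (M n) x (p + 1)) :=
    Module.length_ne_top_iff.1 (ne_top_of_le_ne_top (hne p n) (hbound p n))
  have hrank : (fun n => (Module.finrank R (M n) : ℝ)) =O[atTop]
      (fun n => ((⊤ : Submodule R (M n)).spanFinrank : ℝ)) :=
    IsBigO.of_norm_le fun n => by
      rw [Real.norm_natCast]
      exact_mod_cast finrank_le_spanFinrank R (M n)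
  have hKlittle (p : ℕ) :
      (fun n => ((Module.length R (koszulHomology (M n) x (p + 1))).toNat : ℝ)) =o[atTop]
        (fun n => ((⊤ : Submodule R (M n)).spanFinrank : ℝ)) := by
    have hsum : (fun n => ∑ q ∈ Finset.range (d - p), (d.choose (p + 1 + q) : ℝ) *
        ((Module.length R ((localCohomology (IsLocalRing.maximalIdeal R) q).obj
          (ModuleCat.of R (M n)))).toNat : ℝ)) =o[atTop]
        (fun n => (Module.finrank R (M n) : ℝ)) :=
      IsLittleO.fun_sum fun q hq => (hlittle q
        (by have := Finset.mem_range.1 hq; omega)).const_mul_left _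
    refine (IsBigO.of_norm_le fun n => ?_).trans_isLittleO (hsum.trans_isBigO hrank)
    have h := ENat.toNat_le_toNat (hbound p n) (hne p n)
    rw [ENat.toNat_sum fun q hq => ?_] at h
    · simp only [ENat.toNat_mul, ENat.toNat_natCast] at h
      rw [Real.norm_natCast]
      exact_mod_cast h
    · exact (WithTop.mul_lt_top (ENat.natCast_lt_top _) (lt_top_iff_ne_top.2
        (Module.length_ne_top_iff.2 (hfin n q (by have := Finset.mem_range.1 hq; omega))))).ne
  have hK (i : ℕ) (hi : 1 ≤ i) : ∃ p, i = p + 1 := ⟨i - 1, by omega⟩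
  refine ⟨⟨inferInstance, fun n => (hdim n).trans hd.symm, d, x, hx, fun i hi => ?_⟩,
    ⟨inferInstance, fun n => (hdim n).trans hd.symm, d, x, hx, fun i hi n => ?_, ?_⟩⟩
  · obtain ⟨p, rfl⟩ := hK i hi
    exact ⟨hKfin p, hKlittle p⟩
  · obtain ⟨p, rfl⟩ := hK i hi
    exact hKfin p n
  · simp only [chiOne, Int.cast_sum, Int.cast_mul, Int.cast_pow, Int.cast_neg, Int.cast_one,
      Int.cast_natCast]
    refine IsLittleO.fun_sum fun i hi => ?_
    obtain ⟨p, rfl⟩ := hK i (Finset.mem_Icc.1 hi).1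
    exact (hKlittle p).const_mul_left _
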